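/- **Conventions.** Languages are relational with no nullary predicates; structures are non-empty. For structures $\mathcal{A}_i$ ($i\in I\neq\varnothing$) of a language $\Sigma$, the $E$-combination $\mathcal{A}_E$ is the structure of the language $\Sigma\cup\{E\}$ ($E$ a new binary predicate) on the disjoint union of the $\mathcal{A}_i$ in which $E$ is the equivalence relation with classes the universes of the $\mathcal{A}_i$ and each $R\in\Sigma$ is the union of its interpretations in the $\mathcal{A}_i$; the complete theory $\mathrm{Th}(\mathcal{A}_E)$ is also called an $E$-combination. For a model $M$ of $T=\mathrm{Th}(\mathcal{A}_E)$, each $E$-class of $M$ is regarded as a $\Sigma$-structure by restriction. Let $\mathcal{T}_\varnothing$ be the class of theories of $\Sigma$-structures in which all predicates of $\Sigma$ are empty. The relative $e$-spectrum $e_{\mathcal{T}_\varnothing}\text{-}\mathrm{Sp}(T)$ is the supremum, over all models $M$ of $T$, of the number of complete $\Sigma$-theories that are theories of $E$-classes of models of $T$, are not theories of $E$-classes of $M$, and do not belong to $\mathcal{T}_\varnothing$. **Proposition 2.6.** For every cardinal $\lambda>0$ there are a language $\Sigma$ and structures $\mathcal{A}_i$ ($i\in I$) of $\Sigma$ such that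 the theory $T_0=\mathrm{Th}(\mathcal{A}_E)$ of their $E$-combination has a language $\Sigma\cup\{E\}$ of cardinality $\lambda+1$ and $$e_{\mathcal{T}_\varnothing}\text{-}\mathrm{Sp}(T_0)=\lambda,$$ and such that for every non-empty set $J$ the following holds. Let $\Sigma_j$ ($j\in J$) be pairwise disjoint copies of $\Sigma$, let $\mathcal{A}_i^j$ be the copy of $\mathcal{A}_i$ in the language $\Sigma_j$, regarded as a structure of $\bigcup_{j\in J}\Sigma_j$ with all predicates outside $\Sigma_j$ empty, let $T_j$ be the copy of $T_0$ in the language $\Sigma_j\cup\{E\}$, and let $T$ be the theory of the $E$-combination of all $\mathcal{A}_i^j$ ($i\in I$, $j\in J$). Then: 1. The $E$-classes of every model $M$ of $T$ form copies $T_j$, $j\in J$: there are pairwise disjoint sets $M_j\subseteq M$ ($j\in J$), each a union of $E$-classes, such that each predicate of $\Sigma_j$ holds only on tuples of elements of $M_j$, and $M_j$, in the language $\Sigma_j\cup\{E\}$, is a model of $T_j$. If $J$ is finite, the $M_j$ cover $M$. (So, for infinite $J$, all predicates of $\bigcup_j\Sigma_j$ are empty on any $E$-class outside $\bigcup_j M_j$,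 that is, its theory is in $\mathcal{T}_\varnothing$.) 2. $e_{\mathcal{T}_\varnothing}\text{-}\mathrm{Sp}(T)=|J|\cdot\lambda$. -/

import Mathlib

open FirstOrder FirstOrder.Language.Structure Cardinal

universe u

namespace ECombination

/-- The symbols of the language `{E}`: a single binary predicate `E`. -/
inductive ESymbol : ℕ → Type
  | E : ESymbol 2

/-- The relational language `{E}`. -/
def langE : FirstOrder.Language.{0, 0} := ⟨fun _ => Empty, ESymbol⟩

instance : langE.IsRelational := fun _ => inferInstanceAs (IsEmpty Empty)

/-- The language `Σ ∪ {E}`, with `E` a new binary predicate symbol. -/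
abbrev withE (L : FirstOrder.Language.{u, u}) : FirstOrder.Language.{u, u} := L.sum langE

/-- The symbol `E` of the language `Σ ∪ {E}`. -/
def symE (L : FirstOrder.Language.{u, u}) : (withE L).Relations 2 := Sum.inr ESymbol.E

/-- A predicate symbol of `Σ` as a symbol of `Σ ∪ {E}`. -/
def symL {L : FirstOrder.Language.{u, u}} {n : ℕ} (R : L.Relations n) : (withE L).Relations n := Sum.inl R

section EUnion

variable {L : FirstOrder.Language.{u, u}} {I : Type u} (A : I → Type u)

/-- The universe of the `E`-combination of a family of structures: the disjoint union of their
universes. -/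
def EUnion : Type u := Σ i, A i

/-- The predicates of `Σ` on the `E`-combination: the union of their interpretations in the
members of the family. -/
instance EUnion.structureL [L.IsRelational] [∀ i, L.Structure (A i)] : L.Structure (EUnion A) where
  funMap f := isEmptyElim f
  RelMap R v := ∃ (i : I) (w : Fin _ → A i), (∀ k, v k = ⟨i, w k⟩) ∧ RelMap R w

/-- `E` on the `E`-combination: the equivalence relation whose classes are the universes of the
members of the family. -/
instance EUnion.structureE : langE.Structure (EUnion A) where
  funMap f := Empty.elim f
  RelMap R := match R with
    | ESymbol.E => fun v => (v 0).1 = (v 1).1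

end EUnion

/-- The theory `Comb_E (A_i)_{i ∈ I}`: the complete theory of the `E`-combination, in the language
`Σ ∪ {E}` (structures on an `L.sum L'` are assembled from the two parts above). -/
def combTheory (L : FirstOrder.Language.{u, u}) [L.IsRelational] {I : Type u} (A : I → Type u)
    [∀ i, L.Structure (A i)] : (withE L).Theory :=
  (withE L).completeTheory (EUnion A)

section EClass

variable (L : FirstOrder.Language.{u, u}) (M : Type u) [(withE L).Structure M]

/-- The `E`-class of an element. -/
def EClass (a : M) : Type u := {x : M // RelMap (symE L) ![a, x]}

/-- The restriction of `M` to an `E`-class, as a structure of the language `Σ`. -/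
instance EClass.structure [L.IsRelational] (a : M) : L.Structure (EClass L M a) where
  funMap f := isEmptyElim f
  RelMap R v := RelMap (symL R) fun k => (v k).1

/-- `TH(M)`: the set of the complete theories of the `E`-classes of `M`. -/
def classTheories [L.IsRelational] : Set L.Theory :=
  {S | ∃ a : M, S = L.completeTheory (EClass L M a)}

end EClass

section Spectrum

variable {L : FirstOrder.Language.{u, u}} [L.IsRelational]

/-- The set of the complete theories of `E`-classes of models of `T`. -/
def modelClassTheories (T : (withE L).Theory) : Set L.Theory :=
  {S | ∃ M : T.ModelType.{u, u, u}, S ∈ classTheories L M}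

/-- The relative `e`-spectrum, with respect to a class `𝒯` of theories, of a model `M` of a
complete theory `T`: the number of `E`-classes of models of `T` which are pairwise elementarily
non-equivalent and elementarily non-equivalent to every `E`-class of `M` and to every model of a
theory in `𝒯`. -/
noncomputable def relESpModel (𝒯 : Set L.Theory) (T : (withE L).Theory)
    (M : T.ModelType.{u, u, u}) : Cardinal.{u} :=
  #↥(modelClassTheories T \ (classTheories L M ∪ 𝒯))

/-- The relative `e`-spectrum of a complete theory `T` with respect to `𝒯`: the supremum of the
relative `e`-spectra of its models. -/
noncomputable def relESp (𝒯 : Set L.Theory) (T : (withE L).Theory) : Cardinal.{u} :=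
  sSup (Set.range (relESpModel 𝒯 T))

/-- The supremum in `relESp` is over a bounded set, hence is a genuine one. -/
theorem bddAbove_relESpModel (𝒯 : Set L.Theory) (T : (withE L).Theory) :
    BddAbove (Set.range (relESpModel 𝒯 T)) :=
  ⟨#L.Theory, by rintro _ ⟨M, rfl⟩; exact mk_set_le _⟩

/-- `𝒯_{Σ₀}`: the theories of the structures in which all predicates outside `Σ₀` are empty. -/
def theoriesOver (L : FirstOrder.Language.{u, u}) (S₀ : Set (Σ n, L.Relations n)) : Set L.Theory :=
  {S | ∃ (N : Type u) (_ : L.Structure N), Nonempty N ∧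
    (∀ (n : ℕ) (R : L.Relations n), (⟨n, R⟩ : Σ n, L.Relations n) ∉ S₀ →
      ∀ v : Fin n → N, ¬ RelMap R v) ∧
    S = L.completeTheory N}

end Spectrum

section Copies

/-- The union of pairwise disjoint copies `Σ_j`, `j ∈ J`, of a language `Σ`; `(j, R)` is the copy
of the symbol `R` in `Σ_j`. -/
def copyLang (J : Type u) (L : FirstOrder.Language.{u, u}) : FirstOrder.Language.{u, u} :=
  ⟨fun n => J × L.Functions n, fun n => J × L.Relations n⟩

variable {J : Type u} {L : FirstOrder.Language.{u, u}}

instance [L.IsRelational] : (copyLang J L).IsRelational :=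
  fun n => inferInstanceAs (IsEmpty (J × L.Functions n))

/-- The `j`-th copy of a structure: same universe, and ... -/
def Copy (_j : J) (A : Type u) : Type u := A

/-- ... each `(j, R)` is interpreted as `R`, all predicates of the other copies of `Σ` are empty. -/
instance Copy.structure [L.IsRelational] (j : J) (A : Type u) [L.Structure A] :
    (copyLang J L).Structure (Copy j A) where
  funMap f := isEmptyElim f
  RelMap R v := R.1 = j ∧ RelMap (M := A) R.2 v

/-- The part with index `j` of a structure whose elements are sorted by `c`. -/
def Part {M : Type u} (c : M → Option J) (j : J) : Type u := {x : M // c x = some j}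

/-- The restriction of a structure of the language `⋃_j Σ_j ∪ {E}` to its part with index `j`,
in the language `Σ_j ∪ {E}` identified with `Σ ∪ {E}`. -/
instance Part.structure [L.IsRelational] {M : Type u} [(withE (copyLang J L)).Structure M]
    (c : M → Option J) (j : J) : (withE L).Structure (Part c j) where
  funMap f := isEmptyElim f
  RelMap R v := match R with
    | Sum.inl R => RelMap (L := withE (copyLang J L))
        (symL (L := copyLang J L) ((j, R) : J × L.Relations _)) fun k => (v k).1
    | Sum.inr R => RelMap (L := withE (copyLang J L))
        (Sum.inr R : (withE (copyLang J L)).Relations _) fun k => (v k).1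

/-- The `E`-classes of the structure `M` of the language `⋃_j Σ_j ∪ {E}` form copies, `j ∈ J`, of
the theory `T₀` of the language `Σ ∪ {E}`: they can be distributed between parts with indices
`j ∈ J` (`c x = some j` if the class of `x` is put into the part `j`), so that a predicate of `Σ_j`
can be nonempty only within the part `j`, and the part `j`, in the language `Σ_j ∪ {E}`, is a model
of the copy of `T₀`. Only if `J` is infinite may some classes be left over (`c x = none`), and
these have all predicates of `⋃_j Σ_j` empty. -/
def FormsCopies [L.IsRelational] (T₀ : (withE L).Theory) (M : Type u)
    [(withE (copyLang J L)).Structure M] : Prop :=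
  ∃ c : M → Option J,
    (∀ x y, RelMap (symE (copyLang J L)) ![x, y] → c x = c y) ∧
    (∀ (j : J) (n : ℕ) (R : L.Relations n) (v : Fin n → M),
      RelMap (L := withE (copyLang J L)) (symL (L := copyLang J L) ((j, R) : J × L.Relations n)) v →
        ∀ k, c (v k) = some j) ∧
    (∀ j, Part c j ⊨ T₀) ∧
    (Finite J → ∀ x, c x ≠ none)

end Copies

end ECombination

/-! Take λ unary predicates ("colours") and, for every colour and every positive finite size,
infinitely many one-coloured sets of that size. `ColoredClasses` axiomatizes the theory of their
combination. Its clauses are first-order (`ColoredClasses.of_elementarilyEquivalent`), and any two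
structures satisfying them are elementarily equivalent (`ColoredClasses.elementarilyEquivalent`), by
a back-and-forth that sees only finitely many colours and class sizes up to a finite bound.

The theory of a coloured class depends only on its colour and its size, all infinite sizes being
alike. Finite coloured classes of every kind occur in every model, and colourless classes have
theories in $\mathcal{T}_\varnothing$. What a model can omit is therefore the infinite class of each
colour, and the original combination omits all of these. Hence the spectrum is the number of colours
(`IsMonochromaticFamily.relESp_eq`).

The combination of all copies is of the same kind, with colours indexed by pairs (copy, colour), so
the count is multiplied by $|J|$. Sorting the classes of a model by the copy their colour comes from
gives parts which again satisfy the axioms and so are models of $T_0$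
(`ColoredClasses.formsCopies`). -/

namespace FirstOrder.Language

open BoundedFormula

/-! ### Back-and-forth systems in relational languages. -/

section BackAndForth

variable {L : Language.{u, u}}

/-- The nesting depth of quantifiers. -/
def BoundedFormula.quantifierDepth {α : Type*} : ∀ {n : ℕ}, L.BoundedFormula α n → ℕ
  | _, falsum => 0
  | _, equal _ _ => 0
  | _, rel _ _ => 0
  | _, imp φ ψ => max φ.quantifierDepth ψ.quantifierDepth
  | _, all φ => φ.quantifierDepth + 1

/-- The set of the relation symbols which occur in a formula. -/
def BoundedFormula.relationSymbols {α : Type*} :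
    ∀ {n : ℕ}, L.BoundedFormula α n → Set (Σ l, L.Relations l)
  | _, falsum => ∅
  | _, equal _ _ => ∅
  | _, rel R _ => {⟨_, R⟩}
  | _, imp φ ψ => φ.relationSymbols ∪ ψ.relationSymbols
  | _, all φ => φ.relationSymbols

theorem BoundedFormula.finite_relationSymbols {α : Type*} {n : ℕ} (φ : L.BoundedFormula α n) :
    φ.relationSymbols.Finite := by
  induction φ with
  | falsum => exact Set.finite_empty
  | equal => exact Set.finite_empty
  | rel => exact Set.finite_singleton _
  | imp _ _ h₁ h₂ => exact h₁.union h₂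
  | all _ h => exact h

/-- A graded family of relations between tuples of `M` and of `N` which agree on equality and on
the relation symbols from `F`, and can be extended back and forth at the cost of one grade. -/
structure IsBackAndForth (F : Set (Σ l, L.Relations l)) (M N : Type u) [L.Structure M]
    [L.Structure N] (S : ℕ → ∀ n : ℕ, (Fin n → M) → (Fin n → N) → Prop) : Prop where
  eq_iff : ∀ {r n a b}, S r n a b → ∀ i j, a i = a j ↔ b i = b j
  relMap_iff : ∀ {r n a b}, S r n a b → ∀ {l} (R : L.Relations l), ⟨l, R⟩ ∈ F →
    ∀ g : Fin l → Fin n, RelMap R (a ∘ g) ↔ RelMap R (b ∘ g)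
  forth : ∀ {r n a b}, S (r + 1) n a b → ∀ x, ∃ y, S r (n + 1) (Fin.snoc a x) (Fin.snoc b y)
  back : ∀ {r n a b}, S (r + 1) n a b → ∀ y, ∃ x, S r (n + 1) (Fin.snoc a x) (Fin.snoc b y)

theorem Term.exists_eq_var_inr [L.IsRelational] {n : ℕ} (t : L.Term (Empty ⊕ Fin n)) :
    ∃ i, t = Term.var (Sum.inr i) := by
  rcases t with ⟨e | i⟩ | ⟨f, -⟩
  · exact e.elim
  · exact ⟨i, rfl⟩
  · exact isEmptyElim f

/-- Terms are variables, so the atomic cases are exactly the two agreement clauses; each quantifier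
uses up one grade. -/
theorem IsBackAndForth.realize_iff [L.IsRelational] {F : Set (Σ l, L.Relations l)} {M N : Type u}
    [L.Structure M] [L.Structure N] {S : ℕ → ∀ n : ℕ, (Fin n → M) → (Fin n → N) → Prop}
    (hS : IsBackAndForth F M N S) {n : ℕ} (φ : L.BoundedFormula Empty n)
    (hF : φ.relationSymbols ⊆ F) {r : ℕ} (hr : φ.quantifierDepth ≤ r) {a : Fin n → M}
    {b : Fin n → N} (hab : S r n a b) {v : Empty → M} {w : Empty → N} :
    φ.Realize v a ↔ φ.Realize w b := by
  induction φ generalizing r with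
  | falsum => rfl
  | equal t₁ t₂ =>
    obtain ⟨i, rfl⟩ := t₁.exists_eq_var_inr
    obtain ⟨j, rfl⟩ := t₂.exists_eq_var_inr
    simpa [BoundedFormula.Realize] using hS.eq_iff hab i j
  | rel R ts =>
    choose g hg using fun k => (ts k).exists_eq_var_inr
    obtain rfl : ts = fun k => Term.var (Sum.inr (g k)) := funext hg
    exact hS.relMap_iff hab R (hF rfl) g
  | imp φ ψ ihφ ihψ =>
    exact imp_congr
      (ihφ (Set.subset_union_left.trans hF) ((le_max_left _ _).trans hr) hab)
      (ihψ (Set.subset_union_right.trans hF) ((le_max_right _ _).trans hr) hab)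
  | all φ ih =>
    obtain ⟨r, rfl⟩ : ∃ r', r = r' + 1 := ⟨r - 1, by simp only [quantifierDepth] at hr; omega⟩
    have hr' : φ.quantifierDepth ≤ r := Nat.le_of_succ_le_succ hr
    constructor
    · intro h y
      obtain ⟨x, hx⟩ := hS.back hab y
      exact (ih hF hr' hx).1 (h x)
    · intro h x
      obtain ⟨y, hy⟩ := hS.forth hab x
      exact (ih hF hr' hy).2 (h y)

/-- Two structures are elementarily equivalent as soon as, for every finite set of relation symbols
and every number of steps, there is a back-and-forth system between them. -/
theorem elementarilyEquivalent_of_backAndForth [L.IsRelational] {M N : Type u} [L.Structure M]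
    [L.Structure N]
    (h : ∀ (F : Set (Σ l, L.Relations l)) (q : ℕ), F.Finite →
      ∃ S : ℕ → ∀ n : ℕ, (Fin n → M) → (Fin n → N) → Prop,
        IsBackAndForth F M N S ∧ ∀ a b, S q 0 a b) :
    M ≅[L] N := by
  rw [elementarilyEquivalent_iff]
  intro φ
  obtain ⟨S, hS, hS₀⟩ := h (relationSymbols φ) (quantifierDepth φ) (finite_relationSymbols φ)
  exact hS.realize_iff φ subset_rfl le_rfl (hS₀ _ _)

/-- Elementary equivalence of infinite structures on which every relation symbol is constant
with the same value. -/
theorem elementarilyEquivalent_of_relMap_const [L.IsRelational] {M N : Type u} [L.Structure M]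
    [L.Structure N] [Infinite M] [Infinite N]
    (h : ∀ {l} (R : L.Relations l) (v : Fin l → M) (w : Fin l → N), RelMap R v ↔ RelMap R w) :
    M ≅[L] N := by
  have extend : ∀ {X Y : Type u} [Infinite Y] {n : ℕ} {a : Fin n → X} {b : Fin n → Y},
      (∀ i j, a i = a j ↔ b i = b j) → ∀ x, ∃ y, ∀ i j : Fin (n + 1),
        (Fin.snoc a x : Fin (n + 1) → X) i = (Fin.snoc a x : Fin (n + 1) → X) j ↔
          (Fin.snoc b y : Fin (n + 1) → Y) i = (Fin.snoc b y : Fin (n + 1) → Y) j := by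
    intro X Y _ n a b hab x
    obtain ⟨y, hy⟩ : ∃ y, ∀ i, a i = x ↔ b i = y := by
      by_cases hx : ∃ i, a i = x
      · obtain ⟨i, rfl⟩ := hx
        exact ⟨b i, fun j => hab j i⟩
      -- A new point is answered by any unused point, which exists because `Y` is infinite.
      · obtain ⟨y, hy⟩ := (Set.finite_range b).infinite_compl.nonempty
        exact ⟨y, fun i => iff_of_false (fun h => hx ⟨i, h⟩) fun h => hy ⟨i, h⟩⟩
    refine ⟨y, fun i j => ?_⟩
    induction i using Fin.lastCases <;> induction j using Fin.lastCases <;>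
      simp [hab, hy, eq_comm (a := x), eq_comm (a := y)]
  refine elementarilyEquivalent_of_backAndForth fun F q _ =>
    ⟨fun _ _ a b => ∀ i j, a i = a j ↔ b i = b j, ⟨id, fun _ _ R _ g => h R _ _, extend, ?_⟩,
      fun _ _ i => i.elim0⟩
  intro _ n a b hab y
  obtain ⟨x, hx⟩ := extend (fun i j => (hab i j).symm) y
  exact ⟨x, fun i j => (hx i j).symm⟩

end BackAndForth

end FirstOrder.Language

namespace ECombination

open FirstOrder.Language

/-! ### The axioms on coloured classes and their completeness. -/

section ClassAxioms

/-- All predicate symbols of the language are unary. -/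
class IsMonadic (L : FirstOrder.Language.{u, u}) : Prop where
  arity_eq_one : ∀ {n : ℕ}, L.Relations n → n = 1

/-- Two elements are `E`-equivalent. -/
abbrev SameClass (L : FirstOrder.Language.{u, u}) {M : Type u} [(withE L).Structure M]
    (x y : M) : Prop :=
  RelMap (symE L) ![x, y]

/-- The element `x` has the colour `k`, that is, satisfies the unary predicate `k`. -/
abbrev HasColor {L : FirstOrder.Language.{u, u}} {M : Type u} [(withE L).Structure M]
    (k : L.Relations 1) (x : M) : Prop :=
  RelMap (symL k) ![x]

/-- `E` is an equivalence relation, every class has at most one colour, and for every colour `k` and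
every positive size there are infinitely many classes of this colour and size. If there are only
finitely many colours, then every class has a colour. -/
structure ColoredClasses (L : FirstOrder.Language.{u, u}) (M : Type u)
    [(withE L).Structure M] : Prop where
  equivalence : Equivalence (SameClass L (M := M))
  color_unique : ∀ {k k' : L.Relations 1} {x : M}, HasColor k x → HasColor k' x → k = k'
  color_class : ∀ {k : L.Relations 1} {x y : M}, SameClass L x y → HasColor k x → HasColor k y
  exists_class : ∀ (k : L.Relations 1) (n m : ℕ) (b : Fin m → M), ∃ x : Fin (n + 1) → M,
    Function.Injective x ∧ (∀ i, HasColor k (x i)) ∧ (∀ i t, ¬ SameClass L (b t) (x i)) ∧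
      ∀ i y, SameClass L (x i) y ↔ ∃ i', x i' = y
  colored : Finite (L.Relations 1) → ∀ x : M, ∃ k : L.Relations 1, HasColor k x

variable {L : FirstOrder.Language.{u, u}} {M N : Type u} [(withE L).Structure M]
  [(withE L).Structure N]

/-- The tuples `a` and `b` have the same pattern of equalities and `E`-equivalences, corresponding
elements satisfy the same predicates from `F`, and the sizes of their classes agree up to `q`. -/
structure SimilarTuples (F : Set (L.Relations 1)) (q : ℕ) {n : ℕ} (a : Fin n → M)
    (b : Fin n → N) : Prop where
  eq_iff : ∀ i j, a i = a j ↔ b i = b j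
  sameClass_iff : ∀ i j, SameClass L (a i) (a j) ↔ SameClass L (b i) (b j)
  color_iff : ∀ i, ∀ k ∈ F, HasColor k (a i) ↔ HasColor k (b i)
  size_iff : ∀ i, ∀ s : ℕ, s ≤ q →
    (s ≤ {z | SameClass L (a i) z}.encard ↔ s ≤ {z | SameClass L (b i) z}.encard)

theorem SimilarTuples.symm {F : Set (L.Relations 1)} {q n : ℕ} {a : Fin n → M} {b : Fin n → N}
    (h : SimilarTuples F q a b) : SimilarTuples F q b a :=
  ⟨fun i j => (h.eq_iff i j).symm, fun i j => (h.sameClass_iff i j).symm,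
    fun i k hk => (h.color_iff i k hk).symm, fun i s hs => (h.size_iff i s hs).symm⟩

theorem SimilarTuples.snoc (hM : ColoredClasses L M) (hN : ColoredClasses L N)
    {F : Set (L.Relations 1)} {q n : ℕ} {a : Fin n → M} {b : Fin n → N}
    (h : SimilarTuples F q a b) {x : M} {y : N} (heq : ∀ i, a i = x ↔ b i = y)
    (hE : ∀ i, SameClass L (a i) x ↔ SameClass L (b i) y)
    (hcol : ∀ k ∈ F, HasColor k x ↔ HasColor k y)
    (hsize : ∀ s : ℕ, s ≤ q →
      (s ≤ {z | SameClass L x z}.encard ↔ s ≤ {z | SameClass L y z}.encard)) :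
    SimilarTuples F q (Fin.snoc a x : Fin (n + 1) → M) (Fin.snoc b y : Fin (n + 1) → N) where
  eq_iff i j := by
    induction i using Fin.lastCases <;> induction j using Fin.lastCases <;>
      simp [h.eq_iff, heq, eq_comm (a := x), eq_comm (a := y)]
  sameClass_iff i j := by
    induction i using Fin.lastCases with
    | last =>
      induction j using Fin.lastCases with
      | last => simp [hM.equivalence.refl x, hN.equivalence.refl y]
      | cast j =>
        simp only [Fin.snoc_last, Fin.snoc_castSucc]
        exact ⟨fun e => hN.equivalence.symm ((hE j).1 (hM.equivalence.symm e)),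
          fun e => hM.equivalence.symm ((hE j).2 (hN.equivalence.symm e))⟩
    | cast i =>
      induction j using Fin.lastCases with
      | last => simpa using hE i
      | cast j => simpa using h.sameClass_iff i j
  color_iff i := by
    induction i using Fin.lastCases with
    | last => simpa using hcol
    | cast i => simpa using h.color_iff i
  size_iff i := by
    induction i using Fin.lastCases with
    | last => simpa using hsize
    | cast i => simpa using h.size_iff i

/-- Both maps are injective on a common transversal of their kernel. This counts the points of a
class already chosen on the two sides. -/
theorem encard_image_eq_of_eq_iff {ι X Y : Type*} {f : ι → X} {g : ι → Y}
    (h : ∀ i j, f i = f j ↔ g i = g j) (s : Set ι) : (f '' s).encard = (g '' s).encard := by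
  obtain ⟨t, hts, ht⟩ := (Set.surjOn_image f s).exists_bijOn_subset
  have hg : g '' s = g '' t := by
    refine (Set.image_mono hts).antisymm' ?_
    rintro _ ⟨i, hi, rfl⟩
    obtain ⟨j, hj, hij⟩ := ht.surjOn ⟨i, hi, rfl⟩
    exact ⟨j, hj, (h j i).1 hij⟩
  rw [hg, ← ht.image_eq, ht.injOn.encard_image,
    Set.InjOn.encard_image fun i hi j hj hij => ht.injOn hi hj ((h i j).2 hij)]

theorem SameClass.setOf_eq (hM : ColoredClasses L M) {x y : M} (h : SameClass L x y) :
    {z | SameClass L x z} = {z | SameClass L y z} :=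
  Set.ext fun _ => ⟨hM.equivalence.trans (hM.equivalence.symm h), hM.equivalence.trans h⟩

theorem ColoredClasses.hasColor_iff (hM : ColoredClasses L M) {x y : M} (h : SameClass L x y)
    (k : L.Relations 1) : HasColor k x ↔ HasColor k y :=
  ⟨hM.color_class h, hM.color_class (hM.equivalence.symm h)⟩

/-- A class which avoids a given tuple and has the same colours from a finite set `F` and the same
size up to `q` as a given class of another structure. -/
theorem ColoredClasses.exists_similar_class (hM : ColoredClasses L M) (hN : ColoredClasses L N)
    {F : Set (L.Relations 1)} (hF : F.Finite) {q n : ℕ} (hq : 0 < q) (b : Fin n → N) (x : M) :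
    ∃ y : N, (∀ i, ¬ SameClass L (b i) y) ∧ (∀ k ∈ F, HasColor k x ↔ HasColor k y) ∧
      ∀ s : ℕ, s ≤ q → (s ≤ {z | SameClass L x z}.encard ↔ s ≤ {z | SameClass L y z}.encard) := by
  obtain ⟨k, hk⟩ : ∃ k, ∀ k' ∈ F, HasColor k' x ↔ k' = k := by
    by_cases h : ∃ k : L.Relations 1, HasColor k x
    · obtain ⟨k, hk⟩ := h
      exact ⟨k, fun k' _ => ⟨fun hk' => hM.color_unique hk' hk, by rintro rfl; exact hk⟩⟩
    -- A colourless class forces infinitely many colours; a colour outside `F` then looks like no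
    -- colour at all.
    · have : Infinite (L.Relations 1) := not_finite_iff_infinite.1 fun hfin => h (hM.colored hfin x)
      obtain ⟨k, hk⟩ := hF.infinite_compl.nonempty
      exact ⟨k, fun k' hk' => iff_of_false (fun hx => h ⟨k', hx⟩) (by rintro rfl; exact hk hk')⟩
  -- Here `p + 1` is the size of the class of `x` truncated at `q`; it is positive since the class
  -- contains `x` and `0 < q`.
  obtain ⟨p, hpq, hp⟩ : ∃ p : ℕ, p + 1 ≤ q ∧
      ∀ s : ℕ, s ≤ q → (s ≤ {z | SameClass L x z}.encard ↔ s ≤ p + 1) := by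
    have hx : 1 ≤ {z | SameClass L x z}.encard :=
      Set.one_le_encard_iff_nonempty.2 ⟨x, hM.equivalence.refl x⟩
    generalize {z | SameClass L x z}.encard = c at hx
    induction c using ENat.recTopCoe with
    | top => exact ⟨q - 1, by omega, fun s hs => iff_of_true le_top (by omega)⟩
    | coe c =>
      have : 1 ≤ c := by exact_mod_cast hx
      refine ⟨min c q - 1, by omega, fun s hs => ?_⟩
      rw [Nat.cast_le]
      omega
  obtain ⟨y, hinj, hcol, hb, hclass⟩ := hN.exists_class k p n b
  refine ⟨y 0, hb 0, fun k' hk' => (hk k' hk').trans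
    ⟨by rintro rfl; exact hcol 0, fun h => hN.color_unique h (hcol 0)⟩, fun s hs => ?_⟩
  have : {z | SameClass L (y 0) z} = Set.range y := Set.ext (hclass 0)
  rw [hp s hs, this, ← Set.image_univ, hinj.encard_image, Set.encard_univ,
    ENat.card_eq_coe_fintype_card, Fintype.card_fin, Nat.cast_le]

theorem SimilarTuples.exists_snoc (hM : ColoredClasses L M) (hN : ColoredClasses L N)
    {F : Set (L.Relations 1)} (hF : F.Finite) {q n : ℕ} (hq : n < q) {a : Fin n → M}
    {b : Fin n → N} (h : SimilarTuples F q a b) (x : M) :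
    ∃ y, SimilarTuples F q (Fin.snoc a x : Fin (n + 1) → M) (Fin.snoc b y : Fin (n + 1) → N) := by
  by_cases hx : ∃ i, a i = x
  · obtain ⟨i, rfl⟩ := hx
    exact ⟨b i, h.snoc hM hN (h.eq_iff · i) (h.sameClass_iff · i) (h.color_iff i) (h.size_iff i)⟩
  by_cases hE : ∃ i, SameClass L (a i) x
  · obtain ⟨i, hi⟩ := hE
    -- If the class of `b i` were exhausted by the `c ≤ n` points chosen in it, then the class of `a
    -- i`, which also contains the new `x`, would have at least `c + 1 ≤ q` points. Sizes agree up
    -- to `q`, a contradiction.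
    obtain ⟨y, hy, hyb⟩ : ∃ y, SameClass L (b i) y ∧ ∀ j, b j ≠ y := by
      by_contra! hcon
      let s : Set (Fin n) := {j | SameClass L (a i) (a j)}
      have hb : {z | SameClass L (b i) z} ⊆ b '' s := by
        intro z hz
        obtain ⟨j, rfl⟩ := hcon z hz
        exact ⟨j, (h.sameClass_iff i j).2 hz, rfl⟩
      have ha : insert x (a '' s) ⊆ {z | SameClass L (a i) z} := by
        rintro _ (rfl | ⟨j, hj, rfl⟩)
        exacts [hi, hj]
      have hxs : x ∉ a '' s := fun ⟨j, _, hj⟩ => hx ⟨j, hj⟩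
      have hcard := encard_image_eq_of_eq_iff h.eq_iff s
      have hle : (a '' s).encard ≤ n :=
        (Set.encard_image_le _ _).trans (by
          simpa using Set.encard_le_encard (Set.subset_univ s))
      obtain ⟨c, hc⟩ := ENat.ne_top_iff_exists.1 (ne_top_of_le_ne_top (ENat.natCast_ne_top n) hle)
      rw [← hc, Nat.cast_le] at hle
      have h₁ := Set.encard_le_encard ha
      rw [Set.encard_insert_of_notMem hxs, ← hc] at h₁
      have h₂ := ((h.size_iff i (c + 1) (by omega)).1 (by exact_mod_cast h₁)).trans
        (Set.encard_le_encard hb)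
      rw [← hcard, ← hc, Nat.cast_le] at h₂
      omega
    refine ⟨y, h.snoc hM hN (fun j => iff_of_false (fun hj => hx ⟨j, hj⟩) (hyb j)) (fun j => ?_)
      (fun k hk => ?_) ?_⟩
    · have := h.sameClass_iff j i
      exact ⟨fun e => hN.equivalence.trans (this.1 (hM.equivalence.trans e
        (hM.equivalence.symm hi))) hy, fun e => hM.equivalence.trans (this.2
        (hN.equivalence.trans e (hN.equivalence.symm hy))) hi⟩
    · rw [← hM.hasColor_iff hi, ← hN.hasColor_iff hy, h.color_iff i k hk]
    · rw [← SameClass.setOf_eq hM hi, ← SameClass.setOf_eq hN hy]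
      exact h.size_iff i
  · obtain ⟨y, hyb, hycol, hysize⟩ :=
      hM.exists_similar_class hN hF (Nat.zero_lt_of_lt hq) b x
    refine ⟨y, h.snoc hM hN (fun j => iff_of_false (fun hj => hx ⟨j, hj⟩) ?_)
      (fun j => iff_of_false (fun hj => hE ⟨j, hj⟩) (hyb j)) hycol hysize⟩
    rintro rfl
    exact hyb j (hN.equivalence.refl _)

theorem relMap_withE_iff [IsMonadic L] {n : ℕ} (a : Fin n → M) (b : Fin n → N) {l : ℕ}
    (R : (withE L).Relations l) (g : Fin l → Fin n)
    (hE : ∀ i j, SameClass L (a i) (a j) ↔ SameClass L (b i) (b j))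
    (hcol : ∀ k : L.Relations 1, (⟨1, symL k⟩ : Σ l, (withE L).Relations l) = ⟨l, R⟩ →
      ∀ i, HasColor k (a i) ↔ HasColor k (b i)) :
    RelMap R (a ∘ g) ↔ RelMap R (b ∘ g) := by
  rcases R with R | R
  · obtain rfl := IsMonadic.arity_eq_one R
    have (X : Type u) (f : Fin n → X) : f ∘ g = ![f (g 0)] := by
      ext i
      rw [Subsingleton.elim i 0]
      rfl
    rw [this, this]
    exact hcol R rfl (g 0)
  · rcases R with ⟨⟩
    have (X : Type u) (f : Fin n → X) : f ∘ g = ![f (g 0), f (g 1)] := by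
      ext i
      fin_cases i <;> rfl
    rw [this, this]
    exact hE _ _

theorem ColoredClasses.elementarilyEquivalent [L.IsRelational] [IsMonadic L]
    (hM : ColoredClasses L M) (hN : ColoredClasses L N) : M ≅[withE L] N := by
  refine elementarilyEquivalent_of_backAndForth fun F q hF => ?_
  let F' : Set (L.Relations 1) := {k | (⟨1, symL k⟩ : Σ l, (withE L).Relations l) ∈ F}
  have hF' : F'.Finite := hF.preimage fun k _ k' _ hk =>
    Sum.inl_injective (eq_of_heq (Sigma.mk.inj hk).2)
  -- The bound `n + r ≤ q` gives `n < q` whenever a move remains, as the counting in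
  -- `SimilarTuples.exists_snoc` requires.
  refine ⟨fun r n a b => n + r ≤ q ∧ SimilarTuples F' q a b, ⟨fun h => h.2.eq_iff, ?_, ?_, ?_⟩,
    fun a b => ⟨(zero_add q).le, fun i => i.elim0, fun i => i.elim0, fun i => i.elim0,
      fun i => i.elim0⟩⟩
  · intro r n a b h l R hR g
    refine relMap_withE_iff a b R g h.2.sameClass_iff fun k hk i => h.2.color_iff i k ?_
    change _ ∈ F
    rwa [hk]
  · intro r n a b h x
    obtain ⟨y, hy⟩ := h.2.exists_snoc hM hN hF' (by have := h.1; omega) x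
    exact ⟨y, by have := h.1; omega, hy⟩
  · intro r n a b h y
    obtain ⟨x, hx⟩ := h.2.symm.exists_snoc hN hM hF' (by have := h.1; omega) y
    exact ⟨x, by have := h.1; omega, hx.symm⟩

end ClassAxioms

end ECombination

namespace ECombination

open FirstOrder.Language

/-! ### First-order expressibility of the axioms. -/

section Axiomatization

variable (L : FirstOrder.Language.{u, u})

/-- The atomic formula `E(x, y)`. -/
def sameClassFormula {α : Type*} (x y : α) : (withE L).Formula α :=
  (symE L).formula₂ (Term.var x) (Term.var y)

variable {L}

/-- The atomic formula `k(x)`. -/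
def colorFormula {α : Type*} (k : L.Relations 1) (x : α) : (withE L).Formula α :=
  (symL k).formula₁ (Term.var x)

/-- A formula with parameters `b` and variables `x`: the elements `x` are pairwise distinct, of the
colour `k`, and form an `E`-class to which no element of `b` belongs. -/
noncomputable def isClassFormula (k : L.Relations 1) (n m : ℕ) :
    (withE L).Formula ((Empty ⊕ Fin m) ⊕ Fin (n + 1)) :=
  (Formula.iInf fun p : {p : Fin (n + 1) × Fin (n + 1) // p.1 ≠ p.2} =>
      ∼((Term.var (Sum.inr p.1.1)).equal (Term.var (Sum.inr p.1.2)))) ⊓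
    ((Formula.iInf fun i => colorFormula k (Sum.inr i)) ⊓
    ((Formula.iInf fun p : Fin (n + 1) × Fin m =>
      ∼(sameClassFormula L (Sum.inl (Sum.inr p.2)) (Sum.inr p.1))) ⊓
    Formula.iInf fun i => Formula.iAlls (Fin 1)
      ((sameClassFormula L (Sum.inl (Sum.inr i)) (Sum.inr 0)).iff
        (Formula.iSup fun i' : Fin (n + 1) =>
          (Term.var (Sum.inl (Sum.inr i'))).equal (Term.var (Sum.inr 0))))))

variable {M N : Type u} [(withE L).Structure M] [(withE L).Structure N]

@[simp]
theorem realize_sameClassFormula {α : Type*} (x y : α) (v : α → M) :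
    (sameClassFormula L x y).Realize v ↔ SameClass L (v x) (v y) :=
  Formula.realize_rel₂

@[simp]
theorem realize_colorFormula {α : Type*} (k : L.Relations 1) (x : α) (v : α → M) :
    (colorFormula k x).Realize v ↔ HasColor k (v x) :=
  Formula.realize_rel₁

theorem realize_isClassFormula (k : L.Relations 1) (n m : ℕ) (b : Fin m → M)
    (x : Fin (n + 1) → M) (v : Empty → M) :
    (isClassFormula k n m).Realize (Sum.elim (Sum.elim v b) x) ↔
      Function.Injective x ∧ (∀ i, HasColor k (x i)) ∧ (∀ i t, ¬ SameClass L (b t) (x i)) ∧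
        ∀ i y, SameClass L (x i) y ↔ ∃ i', x i' = y := by
  have hinj : Function.Injective x ↔
      ∀ p : {p : Fin (n + 1) × Fin (n + 1) // p.1 ≠ p.2}, x p.1.1 ≠ x p.1.2 :=
    ⟨fun h p hp => p.2 (h hp), fun h i j hij => by_contra fun hne => h ⟨(i, j), hne⟩ hij⟩
  have hall : ∀ p : (Fin 1 → M) → Prop, (∀ y, p y) ↔ ∀ y, p fun _ => y := fun p =>
    ⟨fun h y => h _, fun h y => by
      have : y = fun _ => y 0 := funext fun i => congrArg y (Subsingleton.elim _ _)
      exact this ▸ h (y 0)⟩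
  simp [isClassFormula, hinj, hall, Prod.forall]

theorem ColoredClasses.of_elementarilyEquivalent (hM : ColoredClasses L M) (h : M ≅[withE L] N) :
    ColoredClasses L N := by
  have transfer : ∀ {φ : (withE L).Sentence}, M ⊨ φ → N ⊨ φ :=
    fun {φ} => (elementarilyEquivalent_iff.1 h φ).1
  refine ⟨⟨?_, ?_, ?_⟩, ?_, ?_, ?_, ?_⟩
  · exact (Relations.realize_reflexive.1 (transfer
      (Relations.realize_reflexive.2 ⟨hM.equivalence.refl⟩))).refl
  · exact fun {x y} => (Relations.realize_symmetric.1 (transfer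
      (Relations.realize_symmetric.2 ⟨fun _ _ => hM.equivalence.symm⟩))).symm x y
  · exact fun {x y z} => (Relations.realize_transitive.1 (transfer
      (Relations.realize_transitive.2 ⟨fun _ _ _ => hM.equivalence.trans⟩))).trans x y z
  · intro k k' x hk hk'
    by_contra hne
    have := transfer (φ := Formula.iAlls (Fin 1)
      (∼(colorFormula k (Sum.inr 0) ⊓ colorFormula k' (Sum.inr 0)))) (by
        simp only [Sentence.Realize, Formula.realize_iAlls, Formula.realize_not,
          Formula.realize_inf, realize_colorFormula, Sum.elim_inr]
        exact fun x hx => hne (hM.color_unique hx.1 hx.2))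
    simp only [Sentence.Realize, Formula.realize_iAlls, Formula.realize_not,
      Formula.realize_inf, realize_colorFormula, Sum.elim_inr] at this
    exact this (fun _ => x) ⟨hk, hk'⟩
  · intro k x y
    have := transfer (φ := Formula.iAlls (Fin 2) ((sameClassFormula L (Sum.inr 0) (Sum.inr 1)).imp
      ((colorFormula k (Sum.inr 0)).imp (colorFormula k (Sum.inr 1))))) (by
        simp only [Sentence.Realize, Formula.realize_iAlls, Formula.realize_imp,
          realize_sameClassFormula, realize_colorFormula, Sum.elim_inr]
        exact fun x hE => hM.color_class hE)
    simp only [Sentence.Realize, Formula.realize_iAlls, Formula.realize_imp,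
      realize_sameClassFormula, realize_colorFormula, Sum.elim_inr] at this
    exact this ![x, y]
  · intro k n m
    have := transfer (φ := Formula.iAlls (Fin m) (Formula.iExs (Fin (n + 1))
      (isClassFormula k n m))) (by
        simp only [Sentence.Realize, Formula.realize_iAlls, Formula.realize_iExs,
          realize_isClassFormula]
        exact hM.exists_class k n m)
    simpa only [Sentence.Realize, Formula.realize_iAlls, Formula.realize_iExs,
      realize_isClassFormula] using this
  -- Having a colour is a disjunction over all colours, hence first-order only when these are
  -- finitely many.
  · intro hfin x
    have := transfer (φ := Formula.iAlls (Fin 1)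
      (Formula.iSup fun k : L.Relations 1 => colorFormula k (Sum.inr 0))) (by
        simp only [Sentence.Realize, Formula.realize_iAlls, Formula.realize_iSup,
          realize_colorFormula, Sum.elim_inr]
        exact fun x => hM.colored hfin _)
    simp only [Sentence.Realize, Formula.realize_iAlls, Formula.realize_iSup,
      realize_colorFormula, Sum.elim_inr] at this
    exact this fun _ => x

end Axiomatization

/-! ### Combinations of one-coloured structures. -/

section MonochromaticFamilies

variable {L : FirstOrder.Language.{u, u}} [L.IsRelational]

/-- A structure on which the only predicate is `k`, and it holds everywhere. -/
def Monochromatic (_k : L.Relations 1) (X : Type u) : Type u := X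

instance Monochromatic.structure (k : L.Relations 1) (X : Type u) :
    L.Structure (Monochromatic k X) where
  funMap f := isEmptyElim f
  RelMap {n} R _ := (⟨n, R⟩ : Σ n, L.Relations n) = ⟨1, k⟩

/-- Every member of the family has exactly one colour, and for every colour and every positive size
there are infinitely many members of this colour and size. -/
structure IsMonochromaticFamily {I : Type u} (A : I → Type u) [∀ i, L.Structure (A i)]
    (color : I → L.Relations 1) : Prop where
  relMap_iff : ∀ i (k : L.Relations 1) (v : Fin 1 → A i), RelMap k v ↔ k = color i
  infinite : ∀ k n, {i | color i = k ∧ Nat.card (A i) = n + 1}.Infinite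

variable {I : Type u} {A : I → Type u} [∀ i, L.Structure (A i)] {color : I → L.Relations 1}

theorem EUnion.sameClass_iff (x y : EUnion A) : SameClass L x y ↔ x.1 = y.1 :=
  Iff.rfl

theorem IsMonochromaticFamily.hasColor_iff (hA : IsMonochromaticFamily A color)
    (k : L.Relations 1) (x : EUnion A) : HasColor k x ↔ k = color x.1 := by
  constructor
  · rintro ⟨i, w, hx, hw⟩
    have : x = ⟨i, w 0⟩ := hx 0
    rw [this]
    exact (hA.relMap_iff i k w).1 hw
  · intro hk
    exact ⟨x.1, fun _ => x.2, fun j => by rw [Subsingleton.elim j 0]; rfl,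
      (hA.relMap_iff _ _ _).2 hk⟩

theorem IsMonochromaticFamily.coloredClasses (hA : IsMonochromaticFamily A color) :
    ColoredClasses L (EUnion A) where
  equivalence := ⟨fun _ => rfl, fun h => Eq.symm h, fun h h' => Eq.trans h h'⟩
  color_unique := by
    intro k k' x hk hk'
    rw [hA.hasColor_iff] at hk hk'
    exact hk.trans hk'.symm
  color_class := by
    intro k x y hE hk
    rw [EUnion.sameClass_iff] at hE
    rw [hA.hasColor_iff] at hk ⊢
    rw [hk, hE]
  colored := fun _ x => ⟨color x.1, (hA.hasColor_iff _ _).2 rfl⟩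
  exists_class := by
    intro k n m b
    -- The parameters `b` meet only finitely many members of the family, so a suitable member avoids
    -- them.
    obtain ⟨i, ⟨rfl, hi⟩, hb⟩ :=
      ((hA.infinite k n).sdiff (Set.finite_range fun t => (b t).1)).nonempty
    have : Finite (A i) := Nat.finite_of_card_ne_zero (by omega)
    let e : Fin (n + 1) ≃ A i := (Finite.equivFinOfCardEq hi).symm
    refine ⟨fun l => ⟨i, e l⟩, sigma_mk_injective.comp e.injective,
      fun l => (hA.hasColor_iff _ _).2 rfl, fun l t h => hb ⟨t, h⟩, fun l y => ?_⟩
    change i = y.1 ↔ _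
    constructor
    · rcases y with ⟨i', y⟩
      rintro (rfl : i = i')
      exact ⟨e.symm y, congrArg (Sigma.mk i) (e.apply_symm_apply y)⟩
    · rintro ⟨l', rfl⟩
      rfl

end MonochromaticFamilies

end ECombination

namespace ECombination

open FirstOrder.Language

/-! ### Theories of single classes. -/

section ClassTheories

variable {L : FirstOrder.Language.{u, u}}
variable {M N : Type u} [(withE L).Structure M] [(withE L).Structure N]

theorem ColoredClasses.nonempty_eClass (hM : ColoredClasses L M) (a : M) :
    Nonempty (EClass L M a) :=
  ⟨⟨a, hM.equivalence.refl a⟩⟩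

theorem EClass.relMap_one_iff [L.IsRelational] {a : M} (k : L.Relations 1)
    (v : Fin 1 → EClass L M a) :
    RelMap k v ↔ HasColor k (v 0).1 := by
  have : (fun i => (v i).1) = ![(v 0).1] := by
    ext i
    rw [Subsingleton.elim i 0]
    rfl
  change RelMap (symL k) (fun i => (v i).1) ↔ _
  rw [this]

theorem ColoredClasses.relMap_eClass_one_iff [L.IsRelational] (hM : ColoredClasses L M) {a : M}
    (k : L.Relations 1)
    (v : Fin 1 → EClass L M a) : RelMap k v ↔ HasColor k a := by
  rw [EClass.relMap_one_iff, ← hM.hasColor_iff (v 0).2]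

theorem ColoredClasses.relMap_eClass_congr [L.IsRelational] [IsMonadic L]
    (hM : ColoredClasses L M) (hN : ColoredClasses L N)
    {a : M} {b : N} (h : ∀ k : L.Relations 1, HasColor k a ↔ HasColor k b) {l : ℕ}
    (R : L.Relations l) (v : Fin l → EClass L M a) (w : Fin l → EClass L N b) :
    RelMap R v ↔ RelMap R w := by
  obtain rfl := IsMonadic.arity_eq_one R
  rw [hM.relMap_eClass_one_iff, hN.relMap_eClass_one_iff, h]

/-- The theory of a class is determined by its colour and its size, if infinite sizes are not
distinguished. -/
theorem ColoredClasses.completeTheory_eClass_eq [L.IsRelational] [IsMonadic L]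
    (hM : ColoredClasses L M)
    (hN : ColoredClasses L N) {a : M} {b : N} {k : L.Relations 1} (ha : HasColor k a)
    (hb : HasColor k b) (hcard : Nat.card (EClass L M a) = Nat.card (EClass L N b)) :
    L.completeTheory (EClass L M a) = L.completeTheory (EClass L N b) := by
  have hrel : ∀ {l : ℕ} (R : L.Relations l) (v : Fin l → EClass L M a) (w : Fin l → EClass L N b),
      RelMap R v ↔ RelMap R w :=
    hM.relMap_eClass_congr hN fun k' => ⟨fun h => hM.color_unique h ha ▸ hb,
      fun h => hN.color_unique h hb ▸ ha⟩
  have := hM.nonempty_eClass a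
  have := hN.nonempty_eClass b
  rcases finite_or_infinite (EClass L M a) with hfin | hinf
  · have : Finite (EClass L N b) :=
      Nat.finite_of_card_ne_zero (hcard ▸ Nat.card_pos.ne')
    let e : EClass L M a ≃[L] EClass L N b :=
      { toEquiv := (Finite.equivFinOfCardEq hcard).trans (Finite.equivFin _).symm
        map_fun' := fun f => isEmptyElim f
        map_rel' := fun R v => (hrel R v _).symm }
    exact e.toElementaryEmbedding.elementarilyEquivalent
  -- `Nat.card` is 0 on infinite types, and a non-empty type with value 0 is infinite.
  · have : Infinite (EClass L N b) := by
      rw [Nat.card_eq_zero_of_infinite] at hcard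
      rcases Nat.card_eq_zero.1 hcard.symm with h | h
      · exact (not_isEmpty_of_nonempty _ h).elim
      · exact h
    exact elementarilyEquivalent_of_relMap_const hrel

theorem ColoredClasses.completeTheory_eClass_mem_theoriesOver_empty [L.IsRelational] [IsMonadic L]
    (hM : ColoredClasses L M)
    {a : M} (ha : ∀ k : L.Relations 1, ¬ HasColor k a) :
    L.completeTheory (EClass L M a) ∈ theoriesOver L ∅ := by
  refine ⟨EClass L M a, inferInstance, hM.nonempty_eClass a, fun n R _ v hv => ?_, rfl⟩
  obtain rfl := IsMonadic.arity_eq_one R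
  exact ha R ((hM.relMap_eClass_one_iff R v).1 hv)

theorem ColoredClasses.exists_eClass_card (hM : ColoredClasses L M) (k : L.Relations 1) (n : ℕ) :
    ∃ a : M, HasColor k a ∧ Nat.card (EClass L M a) = n + 1 := by
  obtain ⟨x, hinj, hcol, -, hx⟩ := hM.exists_class k n 0 Fin.elim0
  refine ⟨x 0, hcol 0, ?_⟩
  have : {z | SameClass L (x 0) z} = Set.range x := Set.ext (hx 0)
  change Nat.card ↥{z | SameClass L (x 0) z} = _
  rw [this, Nat.card_range_of_injective hinj, Nat.card_fin]

/-- Non-emptiness of a predicate is a sentence. This recovers the colour of a class from its theory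
and keeps coloured classes out of $\mathcal{T}_\varnothing$. -/
theorem exists_relMap_of_completeTheory_eq {X Y : Type u} [L.Structure X] [L.Structure Y]
    (h : L.completeTheory X = L.completeTheory Y) (k : L.Relations 1)
    (hX : ∃ v : Fin 1 → X, RelMap k v) : ∃ v : Fin 1 → Y, RelMap k v := by
  have realize : ∀ (Z : Type u) [L.Structure Z],
      Z ⊨ Formula.iExs (α := Empty) (Fin 1) (k.formula fun i => Term.var (Sum.inr i)) ↔
        ∃ v : Fin 1 → Z, RelMap k v := by
    intro Z _
    simp [Sentence.Realize]
  rw [← realize] at hX ⊢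
  exact (elementarilyEquivalent_iff.1 h _).1 hX

theorem ColoredClasses.hasColor_of_completeTheory_eq [L.IsRelational] (hM : ColoredClasses L M)
    (hN : ColoredClasses L N) {a : M} {b : N}
    (h : L.completeTheory (EClass L M a) = L.completeTheory (EClass L N b)) {k : L.Relations 1}
    (ha : HasColor k a) : HasColor k b := by
  obtain ⟨w, hw⟩ := exists_relMap_of_completeTheory_eq h k
    ⟨fun _ => ⟨a, hM.equivalence.refl a⟩, (hM.relMap_eClass_one_iff k _).2 ha⟩
  exact (hN.relMap_eClass_one_iff k w).1 hw

end ClassTheories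

/-! ### Computation of the relative spectrum. -/

section Spectrum

variable {L : FirstOrder.Language.{u, u}}

/-- A set with one element if `s = some 0`, with two elements if `s = some 1`, and so on, and an
infinite set if `s = none`. -/
def sizedSet : Option ℕ → Type u
  | none => ULift ℕ
  | some n => ULift (Fin (n + 1))

theorem natCard_sizedSet_some (n : ℕ) : Nat.card (sizedSet (some n)) = n + 1 := by
  simp [sizedSet]

variable (L) in
/-- Infinitely many monochromatic sets of every colour and every size, including an infinite one. -/
abbrev allSizes [L.IsRelational] (p : L.Relations 1 × ℕ × Option ℕ) : Type u :=
  Monochromatic p.1 (sizedSet p.2.2)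

theorem Monochromatic.relMap_iff [L.IsRelational] (k k' : L.Relations 1) {X : Type u}
    (v : Fin 1 → Monochromatic k' X) : RelMap k v ↔ k = k' := by
  change ((⟨1, k⟩ : Σ n, L.Relations n) = ⟨1, k'⟩) ↔ _
  simp

-- The additional infinite members do not disturb the axioms, so this combination is a model of the
-- same theory that does realize the infinite classes.
variable (L) in
theorem isMonochromaticFamily_allSizes [L.IsRelational] : IsMonochromaticFamily
    (allSizes L) Prod.fst where
  relMap_iff _ _ v := Monochromatic.relMap_iff _ _ v
  infinite k n := by
    have : Function.Injective fun m : ℕ => (k, m, some n) := fun _ _ h => by simpa using h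
    refine (Set.infinite_range_of_injective this).mono ?_
    rintro _ ⟨m, rfl⟩
    exact ⟨rfl, natCard_sizedSet_some n⟩

/-- The `E`-classes of an `E`-combination are the members of the family. -/
def EUnion.eClassEquiv [L.IsRelational] {I : Type u} {A : I → Type u} [∀ i, L.Structure (A i)]
    (x : EUnion A) :
    EClass L (EUnion A) x ≃ A x.1 :=
  (Equiv.subtypeEquivRight fun _ => eq_comm).trans (Equiv.sigmaSubtype x.1)

variable (L) in
/-- An element of an infinite class of colour `k`. -/
def infiniteClassElement [L.IsRelational] (k : L.Relations 1) : EUnion (allSizes L) :=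
  ⟨(k, 0, none), (⟨0⟩ : ULift ℕ)⟩

variable (L) in
/-- The theory of an infinite class of colour `k`. -/
noncomputable def infiniteClassTheory [L.IsRelational] (k : L.Relations 1) : L.Theory :=
  L.completeTheory (EClass L (EUnion (allSizes L)) (infiniteClassElement L k))

theorem hasColor_infiniteClassElement [L.IsRelational] (k : L.Relations 1) :
    HasColor k (infiniteClassElement L k) :=
  ((isMonochromaticFamily_allSizes L).hasColor_iff _ _).2 rfl

theorem infinite_infiniteClass [L.IsRelational] (k : L.Relations 1) :
    Infinite (EClass L (EUnion (allSizes L)) (infiniteClassElement L k)) :=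
  (EUnion.eClassEquiv (infiniteClassElement L k)).infinite_iff.2
    (inferInstanceAs (Infinite (ULift ℕ)))

variable {I : Type u} {A : I → Type u} [∀ i, L.Structure (A i)] {color : I → L.Relations 1}

theorem IsMonochromaticFamily.coloredClasses_of_model [L.IsRelational]
    (hA : IsMonochromaticFamily A color)
    (M : Type u) [(withE L).Structure M] (hM : M ⊨ combTheory L A) : ColoredClasses L M :=
  hA.coloredClasses.of_elementarilyEquivalent (elementarilyEquivalent_iff.2 fun φ =>
    (@realize_iff_of_model_completeTheory (withE L) (EUnion A) M _ _ hM φ).symm)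

theorem IsMonochromaticFamily.model_of_coloredClasses [L.IsRelational] [IsMonadic L]
    (hA : IsMonochromaticFamily A color)
    {M : Type u} [(withE L).Structure M] (hM : ColoredClasses L M) : M ⊨ combTheory L A :=
  (hA.coloredClasses.elementarilyEquivalent hM).theory_model_iff.1
    ((withE L).model_completeTheory)

theorem IsMonochromaticFamily.relESpModel_le [L.IsRelational] [IsMonadic L]
    (hA : IsMonochromaticFamily A color)
    (M : (combTheory L A).ModelType) :
    relESpModel (theoriesOver L ∅) (combTheory L A) M ≤ #(L.Relations 1) := by
  have hM := hA.coloredClasses_of_model M M.is_model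
  have hallSizes := (isMonochromaticFamily_allSizes L).coloredClasses
  refine (mk_le_mk_of_subset ?_).trans (mk_range_le (f := infiniteClassTheory L))
  rintro _ ⟨⟨N, a, rfl⟩, hna⟩
  have hN := hA.coloredClasses_of_model N N.is_model
  by_cases ha : ∃ k : L.Relations 1, HasColor k a
  · obtain ⟨k, ha⟩ := ha
    have := hN.nonempty_eClass a
    have := infinite_infiniteClass k
    rcases finite_or_infinite (EClass L N a) with hfin | hinf
    -- A finite coloured class has a twin of the same colour and size in `M`, so its theory is not
    -- omitted.
    · obtain ⟨b, hb, hcard⟩ := hM.exists_eClass_card k (Nat.card (EClass L N a) - 1)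
      refine (hna (Or.inl ⟨b, hN.completeTheory_eClass_eq hM ha hb ?_⟩)).elim
      rw [hcard, Nat.sub_add_cancel Nat.card_pos]
    · exact ⟨k, hallSizes.completeTheory_eClass_eq hN (hasColor_infiniteClassElement k) ha
        (by rw [Nat.card_eq_zero_of_infinite, Nat.card_eq_zero_of_infinite])⟩
  · exact (hna (Or.inr
      (hN.completeTheory_eClass_mem_theoriesOver_empty (not_exists.1 ha)))).elim

/-- The supremum is attained at the combination itself: its classes are finite, so it omits the
infinite class of every colour, and these are realized in the combination of `allSizes`. -/
theorem IsMonochromaticFamily.relESp_eq [L.IsRelational] [IsMonadic L]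
    (hA : IsMonochromaticFamily A color) [Nonempty I]
    [∀ i, Nonempty (A i)] [∀ i, Finite (A i)] :
    relESp (theoriesOver L ∅) (combTheory L A) = #(L.Relations 1) := by
  have hAE := hA.coloredClasses
  have hallSizes := (isMonochromaticFamily_allSizes L).coloredClasses
  refine le_antisymm (csSup_le' ?_) ?_
  · rintro _ ⟨M, rfl⟩
    exact hA.relESpModel_le M
  have : Nonempty (EUnion A) := ⟨⟨Classical.arbitrary I, Classical.arbitrary _⟩⟩
  have hmodel : EUnion A ⊨ combTheory L A := hA.model_of_coloredClasses hAE
  refine le_csSup_of_le (bddAbove_relESpModel _ _) ⟨Theory.ModelType.of _ (EUnion A), rfl⟩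
    (mk_le_of_injective (f := fun k => ⟨infiniteClassTheory L k, ?_, ?_⟩) ?_)
  · have : Nonempty (EUnion (allSizes L)) := ⟨infiniteClassElement L k⟩
    have := hA.model_of_coloredClasses hallSizes
    exact ⟨Theory.ModelType.of _ (EUnion (allSizes L)), infiniteClassElement L k, rfl⟩
  · rintro (⟨a, ha⟩ | ⟨X, _, -, hX, h⟩)
    · change EUnion A at a
      have : Finite (EClass L (EUnion A) a) := Finite.of_equiv _ (EUnion.eClassEquiv a).symm
      have h : EClass L (EUnion (allSizes L)) (infiniteClassElement L k) ≅[L]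
        EClass L (EUnion A) a := ha
      exact not_finite_iff_infinite.2 (h.infinite_iff.1 (infinite_infiniteClass k)) this
    · obtain ⟨v, hv⟩ := exists_relMap_of_completeTheory_eq h k
        ⟨fun _ => ⟨_, hallSizes.equivalence.refl _⟩,
          (hallSizes.relMap_eClass_one_iff k _).2 (hasColor_infiniteClassElement k)⟩
      exact hX 1 k (Set.notMem_empty _) v hv
  · intro k k' h
    exact hallSizes.color_unique (hallSizes.hasColor_of_completeTheory_eq hallSizes
      (Subtype.ext_iff.1 h) (hasColor_infiniteClassElement k)) (hasColor_infiniteClassElement k')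

end Spectrum

end ECombination

namespace ECombination

open FirstOrder.Language

/-! ### Disjoint copies and the decomposition of models. -/

section Copies

variable {J : Type u} {L : FirstOrder.Language.{u, u}}

/-- The `j`-th copy of a colour. -/
def copyColor (j : J) (k : L.Relations 1) : (copyLang J L).Relations 1 := (j, k)

instance copyLang.isMonadic [IsMonadic L] : IsMonadic (copyLang J L) :=
  ⟨fun R => IsMonadic.arity_eq_one (L := L) R.2⟩

theorem IsMonochromaticFamily.copy [L.IsRelational] {I : Type u} {A : I → Type u}
    [∀ i, L.Structure (A i)] {color : I → L.Relations 1} (hA : IsMonochromaticFamily A color) :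
    IsMonochromaticFamily (L := copyLang J L) (fun p : J × I => Copy p.1 (A p.2))
      fun p => copyColor p.1 (color p.2) where
  relMap_iff := by
    rintro ⟨j, i⟩ ⟨j', k⟩ v
    exact (and_congr_right' (hA.relMap_iff i k v)).trans Prod.mk_inj.symm
  infinite := by
    rintro ⟨j, k⟩ n
    refine ((hA.infinite k n).image (Prod.mk_right_injective j).injOn).mono ?_
    rintro _ ⟨i, ⟨rfl, hi⟩, rfl⟩
    exact ⟨rfl, hi⟩

variable {M : Type u} [(withE (copyLang J L)).Structure M] {c : M → Option J}
  {j : J}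

theorem Part.sameClass_iff [L.IsRelational] (x y : Part c j) :
    SameClass L x y ↔ SameClass (copyLang J L) x.1 y.1 := by
  have : (fun i => (![x, y] i).1) = ![x.1, y.1] := by
    ext i
    fin_cases i <;> rfl
  change RelMap (symE (copyLang J L)) (fun i => (![x, y] i).1) ↔ _
  rw [this]

theorem Part.hasColor_iff [L.IsRelational] (k : L.Relations 1) (x : Part c j) :
    HasColor k x ↔ HasColor (copyColor j k) x.1 := by
  have : (fun i => (![x] i).1) = ![x.1] := by
    ext i
    rw [Subsingleton.elim i 0]
    rfl
  change RelMap (symL (copyColor j k)) (fun i => (![x] i).1) ↔ _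
  rw [this]

/-- By `hcolor`, a class of `M` with a colour from copy `j` lies wholly in the part, so the required
classes survive restriction. -/
theorem ColoredClasses.part [L.IsRelational] (hM : ColoredClasses (copyLang J L) M)
    (hcolor : ∀ (k : L.Relations 1) (x : M), HasColor (copyColor j k) x → c x = some j)
    (hcolored : Finite (L.Relations 1) → ∀ x, c x = some j →
      ∃ k : L.Relations 1, HasColor (copyColor j k) x) :
    ColoredClasses L (Part c j) where
  equivalence := by
    refine ⟨fun x => ?_, fun {x y} => ?_, fun {x y z} => ?_⟩ <;> simp only [Part.sameClass_iff]
    exacts [hM.equivalence.refl _, hM.equivalence.symm, hM.equivalence.trans]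
  color_unique := by
    intro k k' x
    simp only [Part.hasColor_iff]
    exact fun h h' => (Prod.mk_inj.1 (hM.color_unique h h')).2
  color_class := by
    intro k x y
    simp only [Part.hasColor_iff, Part.sameClass_iff]
    exact hM.color_class
  exists_class := by
    intro k n m b
    obtain ⟨x, hinj, hcol, hb, hx⟩ := hM.exists_class (copyColor j k) n m fun t => (b t).1
    refine ⟨fun i => ⟨x i, hcolor k _ (hcol i)⟩, fun i i' h => hinj (Subtype.ext_iff.1 h),
      fun i => (Part.hasColor_iff _ _).2 (hcol i), fun i t h => hb i t
        ((Part.sameClass_iff _ _).1 h), fun i y => ?_⟩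
    exact ((Part.sameClass_iff _ y).trans (hx i y.1)).trans
      (exists_congr fun i' => Subtype.ext_iff.symm)
  colored := by
    intro hfin x
    simp only [Part.hasColor_iff]
    exact hcolored hfin x.1 x.2

open Classical in
/-- A class of a colour from the `j`-th copy is put into the part `j`; a class without a colour is
put into an arbitrary part if there are only finitely many parts, and left over otherwise. -/
noncomputable def sortByColor (J : Type u) [Nonempty J] (L : FirstOrder.Language.{u, u})
    {M : Type u} [(withE (copyLang J L)).Structure M] (x : M) : Option J :=
  if h : ∃ p : J × L.Relations 1, HasColor (copyColor p.1 p.2) x then some h.choose.1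
  else if Finite J then some (Classical.arbitrary J) else none

theorem ColoredClasses.sortByColor_eq [Nonempty J] (hM : ColoredClasses (copyLang J L) M) {x : M}
    {k : L.Relations 1} (h : HasColor (copyColor j k) x) : sortByColor J L x = some j := by
  have hex : ∃ p : J × L.Relations 1, HasColor (copyColor p.1 p.2) x := ⟨(j, k), h⟩
  rw [sortByColor, dif_pos hex]
  exact congrArg some (Prod.mk_inj.1 (hM.color_unique hex.choose_spec h)).1

theorem ColoredClasses.formsCopies [L.IsRelational] [IsMonadic L] [Nonempty J]
    (hM : ColoredClasses (copyLang J L) M) {I : Type u} {A : I → Type u}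
    [∀ i, L.Structure (A i)] {color : I → L.Relations 1} (hA : IsMonochromaticFamily A color) :
    FormsCopies (J := J) (combTheory L A) M := by
  have hclass : ∀ x y : M, SameClass (copyLang J L) x y →
      sortByColor J L x = sortByColor J L y := by
    intro x y h
    by_cases hx : ∃ p : J × L.Relations 1, HasColor (copyColor p.1 p.2) x
    · obtain ⟨p, hp⟩ := hx
      rw [hM.sortByColor_eq hp, hM.sortByColor_eq (hM.color_class h hp)]
    · have hy : ¬ ∃ p : J × L.Relations 1, HasColor (copyColor p.1 p.2) y :=
        fun ⟨p, hp⟩ => hx ⟨p, (hM.hasColor_iff h _).2 hp⟩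
      rw [sortByColor, sortByColor, dif_neg hx, dif_neg hy]
  refine ⟨sortByColor J L, hclass, fun j n R v hv i => ?_, fun j => ?_, fun hJ x => ?_⟩
  · obtain rfl := IsMonadic.arity_eq_one R
    refine hM.sortByColor_eq (k := R) ?_
    have : v = ![v i] := by
      ext l
      rw [Subsingleton.elim l i, Subsingleton.elim i 0]
      rfl
    rw [HasColor, ← this]
    exact hv
  · refine hA.model_of_coloredClasses (hM.part (fun k x => hM.sortByColor_eq) ?_)
    intro hfin x hx
    by_cases hcol : ∃ p : J × L.Relations 1, HasColor (copyColor p.1 p.2) x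
    · obtain ⟨⟨j', k⟩, hk⟩ := hcol
      obtain rfl := Option.some_injective _ ((hM.sortByColor_eq hk).symm.trans hx)
      exact ⟨k, hk⟩
    -- A colourless `x` enters a part only if `J` is finite; as `L` has finitely many colours here,
    -- so has the union of the copies, and no class of `M` is colourless.
    · by_cases hJ : Finite J
      · have : Finite ((copyLang J L).Relations 1) :=
          inferInstanceAs (Finite (J × L.Relations 1))
        obtain ⟨p, hp⟩ := hM.colored this x
        exact (hcol ⟨p, hp⟩).elim
      · rw [sortByColor, dif_neg hcol, if_neg hJ] at hx
        cases hx
  · rw [sortByColor]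
    split_ifs
    all_goals exact Option.some_ne_none _

end Copies

/-! ### The witnessing language and family. -/

section MonadicLanguage

/-- The language with the set `K` of unary predicates. -/
def monadicLang (K : Type u) : FirstOrder.Language.{u, u} :=
  ⟨fun _ => PEmpty, fun n => {_k : K // n = 1}⟩

variable (K : Type u)

instance : (monadicLang K).IsRelational :=
  fun _ => inferInstanceAs (IsEmpty PEmpty)

instance : IsMonadic (monadicLang K) := ⟨fun R => R.2⟩

instance : IsEmpty ((monadicLang K).Relations 0) := ⟨fun R => zero_ne_one R.2⟩

/-- The unary predicates of `monadicLang K` are the elements of `K`. -/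
def monadicLangRelationsEquiv : (monadicLang K).Relations 1 ≃ K where
  toFun R := R.1
  invFun k := ⟨k, rfl⟩
  left_inv _ := rfl
  right_inv _ := rfl

theorem card_monadicLang : (monadicLang K).card = #K :=
  mk_congr
    { toFun := Sum.elim (fun f => f.2.elim) fun R => R.2.1
      invFun := fun k => Sum.inr ⟨1, k, rfl⟩
      left_inv := by
        rintro (⟨_, f⟩ | ⟨_, k, rfl⟩)
        exacts [f.elim, rfl]
      right_inv := fun _ => rfl }

theorem card_langE : langE.card = 1 := by
  have : Unique langE.Symbols :=
    { default := Sum.inr ⟨2, ESymbol.E⟩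
      uniq := by
        rintro (⟨_, f⟩ | ⟨_, ⟨⟩⟩)
        exacts [f.elim, rfl] }
  exact mk_eq_one _

theorem card_withE_monadicLang : (withE (monadicLang K)).card = #K + 1 := by
  rw [card_sum, card_monadicLang, card_langE]
  simp

/-- Infinitely many monochromatic sets of every colour and every finite size. -/
abbrev finiteSizes (L : FirstOrder.Language.{u, u}) (p : L.Relations 1 × ℕ × ℕ) : Type u :=
  Monochromatic p.1 (ULift (Fin (p.2.2 + 1)))

theorem isMonochromaticFamily_finiteSizes (L : FirstOrder.Language.{u, u}) [L.IsRelational] :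
    IsMonochromaticFamily (finiteSizes L) Prod.fst where
  relMap_iff _ _ v := Monochromatic.relMap_iff _ _ v
  infinite k n := by
    have : Function.Injective fun m : ℕ => (k, m, n) := fun _ _ h => by simpa using h
    refine (Set.infinite_range_of_injective this).mono ?_
    rintro _ ⟨m, rfl⟩
    exact ⟨rfl, by simp [finiteSizes, Monochromatic]⟩

end MonadicLanguage

end ECombination

theorem proposition2p6 (κ : Cardinal.{u}) (hκ : 0 < κ) :
    ∃ (L : FirstOrder.Language.{u, u}) (_ : L.IsRelational) (I : Type u) (A : I → Type u)
      (_ : ∀ i, L.Structure (A i)),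
      IsEmpty (L.Relations 0) ∧ Nonempty I ∧ (∀ i, Nonempty (A i)) ∧
      (ECombination.withE L).card = κ + 1 ∧
      ECombination.relESp (ECombination.theoriesOver L ∅) (ECombination.combTheory L A) = κ ∧
      ∀ (J : Type u) [Nonempty J],
        ∃ T : (ECombination.withE (ECombination.copyLang J L)).Theory,
          T = ECombination.combTheory (ECombination.copyLang J L)
            (fun p : J × I => ECombination.Copy p.1 (A p.2)) ∧
          (∀ M : T.ModelType.{u, u, u},
            ECombination.FormsCopies (J := J) (ECombination.combTheory L A) M) ∧
          ECombination.relESp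
            (ECombination.theoriesOver (ECombination.copyLang J L) ∅) T = #J * κ := by
  induction κ using Cardinal.inductionOn with | _ K
  have hK : Nonempty K := mk_ne_zero_iff.1 hκ.ne'
  let L := ECombination.monadicLang K
  have hL : #(L.Relations 1) = #K := mk_congr (ECombination.monadicLangRelationsEquiv K)
  have : Nonempty (L.Relations 1) := (ECombination.monadicLangRelationsEquiv K).nonempty
  have hA := ECombination.isMonochromaticFamily_finiteSizes L
  have hne : ∀ p, Nonempty (ECombination.finiteSizes L p) := fun _ => ⟨(⟨0⟩ : ULift (Fin _))⟩
  have hfin : ∀ p, Finite (ECombination.finiteSizes L p) := fun _ =>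
    inferInstanceAs (Finite (ULift (Fin _)))
  refine ⟨L, inferInstance, _, ECombination.finiteSizes L, inferInstance,
    inferInstanceAs (IsEmpty ((ECombination.monadicLang K).Relations 0)), inferInstance, hne,
    ECombination.card_withE_monadicLang K, hA.relESp_eq.trans hL, fun J _ =>
      ⟨_, rfl, fun M => (hA.copy.coloredClasses_of_model M M.is_model).formsCopies hA, ?_⟩⟩
  have (p : J × (L.Relations 1 × ℕ × ℕ)) :
      Nonempty (ECombination.Copy p.1 (ECombination.finiteSizes L p.2)) := hne p.2
  have (p : J × (L.Relations 1 × ℕ × ℕ)) :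
      Finite (ECombination.Copy p.1 (ECombination.finiteSizes L p.2)) := hfin p.2
  -- The copied family is again monochromatic, so the same count applies with colours `J ×
  -- L.Relations 1`.
  rw [(hA.copy (J := J)).relESp_eq, ← hL]
  exact mul_def J (L.Relations 1) |>.symm
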